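/- Knots are unoriented and are considered up to isotopy; they are given by planar diagrams, two diagrams representing the same (isotopic) knots if they are related by planar isotopies and Reidemeister moves. A knot is distinguished from its mirror image. For a knot diagram $D$ let $\mathrm{tri}(D)$ be the number of its proper, possibly trivial, tricolorings, that is, of the assignments of one of three colors to each arc of $D$ such that at each crossing the three colors that meet are all equal or all different. For a knot $K$ let $\mathrm{tri}(K)$ be the minimum of $\mathrm{tri}(D)$ over all diagrams $D$ of $K$, and $\beta(K)=\log_3 \mathrm{tri}(K)$. The Gordian graph (respectively, the $H(2)$-Gordian graph) is the simple graph whose vertices are the isotopy classes of unoriented knots, two different classes being adjacent if they have diagrams related by one crossing change (respectively, by one component-preserving $H(2)$-move, that is, one replacement $)( \leftrightarrow \asymp$ of a tangle in the diagram that turns a knot into a knot). The quotient of such a graph by $\beta$ is the simple graph whose vertices are the classes of knots with equal $\beta$, two different classes being adjacent if they contain knots that are adjacent in the original graph. Let $P_{\mathbb N}$ be the graph with the vertices $1,2,3,\dots$ and the edges $\{n,n+1\}$, $n\ge 1$. **Theorem 1.2.** The quotient of the Gordian graph by $\beta$ and the quotient of the $H(2)$-Gordian graph by $\beta$ are both isomorphic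 to $P_{\mathbb N}$. In both cases $[K]\mapsto\beta(K)$ is (well defined with values in the positive integers and) such an isomorphism. More precisely: 1. $\mathrm{tri}(D)=\mathrm{tri}(K)$ for every diagram $D$ of a knot $K$. 2. For every $n\ge 0$, the connected sum $\#^n T(2,3)$ of $n$ trefoils (the unknot for $n=0$) satisfies $\beta(\#^nT(2,3))=n+1$, and $\#^nT(2,3)$ and $\#^{n+1}T(2,3)$ are adjacent both in the Gordian graph and in the $H(2)$-Gordian graph. 3. If $K$ and $K'$ are adjacent in the Gordian graph or in the $H(2)$-Gordian graph, then $\mathrm{tri}(K)\le 3\,\mathrm{tri}(K')$ and $\mathrm{tri}(K')\le 3\,\mathrm{tri}(K)$. -/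

import Mathlib

namespace KnotTheory

/-! ### Unoriented diagrams

A diagram in the plane, in general position with respect to the height function, is read from
bottom to top as a sequence of layers.  Each layer contains exactly one local minimum (`cup`),
local maximum (`cap`) or crossing, and otherwise only vertical strands. -/

/-- The piece of a diagram that a layer contains: a local minimum `∪`, a local maximum `∩`, or a
crossing.  In `cross true` the strand running from bottom left to top right is the over-strand,
in `cross false` the strand running from bottom right to top left is the over-strand. -/
inductive Piece where
  | cup
  | cap
  | cross (b : Bool)
  deriving DecidableEq

/-- The number of strand ends at the bottom of a piece. -/
def Piece.bot : Piece → ℕ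
  | .cup => 0
  | .cap => 2
  | .cross _ => 2

/-- The number of strand ends at the top of a piece. -/
def Piece.top : Piece → ℕ
  | .cup => 2
  | .cap => 0
  | .cross _ => 2

/-- A layer: a piece with `pos` vertical strands to its left (and any number to its right). -/
structure Layer where
  piece : Piece
  pos : ℕ

/-- The number of strands above the layers `w`, if there are `n` strands below them; the value is
`none` if some layer needs more strands than there are. -/
def width : ℕ → List Layer → Option ℕ
  | n, [] => some n
  | n, l :: w => if l.pos + l.piece.bot ≤ n then width (n - l.piece.bot + l.piece.top) w else none

/-- The word `w` is a diagram of a link: it starts and ends with no strand. -/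
def IsClosed (w : List Layer) : Prop := width 0 w = some 0

/-- `(t, p)` is a point of the diagram: strand number `p` (counted from the left, from `0` on)
just above the first `t` layers. -/
def IsPoint (w : List Layer) (x : ℕ × ℕ) : Prop :=
  x.1 ≤ w.length ∧ ∃ n, width 0 (w.take x.1) = some n ∧ x.2 < n

/-- Two points are joined by a piece of the curve inside one layer. -/
inductive Joined (w : List Layer) : ℕ × ℕ → ℕ × ℕ → Prop
  | left {t p : ℕ} {k : Piece} {i : ℕ} (h : w[t]? = some ⟨k, i⟩) (hp : p < i) :
      Joined w (t, p) (t + 1, p)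
  | right {t : ℕ} {k : Piece} {i : ℕ} (h : w[t]? = some ⟨k, i⟩) (p : ℕ) :
      Joined w (t, i + k.bot + p) (t + 1, i + k.top + p)
  | cup {t i : ℕ} (h : w[t]? = some ⟨.cup, i⟩) : Joined w (t + 1, i) (t + 1, i + 1)
  | cap {t i : ℕ} (h : w[t]? = some ⟨.cap, i⟩) : Joined w (t, i) (t, i + 1)
  | crossRight {t : ℕ} {b : Bool} {i : ℕ} (h : w[t]? = some ⟨.cross b, i⟩) :
      Joined w (t, i) (t + 1, i + 1)
  | crossLeft {t : ℕ} {b : Bool} {i : ℕ} (h : w[t]? = some ⟨.cross b, i⟩) :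
      Joined w (t, i + 1) (t + 1, i)

/-- A diagram of an unoriented knot: a link diagram that consists of exactly one closed curve. -/
structure KnotDiagram where
  word : List Layer
  closed : IsClosed word
  nonempty : ∃ x, IsPoint word x
  connected : ∀ x y, IsPoint word x → IsPoint word y → Relation.EqvGen (Joined word) x y

/-! ### Isotopy -/

/-- The local moves: planar isotopies of diagrams (far apart pieces change heights, a maximum and
a minimum cancel, a strand crossing an extremum slides across it) and the three Reidemeister
moves. -/
inductive LocalMove : List Layer → List Layer → Prop
  /-- A piece `a` and a piece `b` to the right of `a` change heights. -/
  | exchange (a b : Piece) (i k : ℕ) :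
      LocalMove [⟨a, i⟩, ⟨b, i + a.top + k⟩] [⟨b, i + a.bot + k⟩, ⟨a, i⟩]
  /-- Straightening of a strand. -/
  | zigzag (i : ℕ) : LocalMove [⟨.cup, i⟩, ⟨.cap, i + 1⟩] []
  | zagzig (i : ℕ) : LocalMove [⟨.cup, i + 1⟩, ⟨.cap, i⟩] []
  /-- A strand over (or under) one leg of an extremum slides to the other leg. -/
  | slideCup (b : Bool) (i : ℕ) :
      LocalMove [⟨.cup, i + 1⟩, ⟨.cross b, i⟩] [⟨.cup, i⟩, ⟨.cross (!b), i + 1⟩]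
  | slideCap (b : Bool) (i : ℕ) :
      LocalMove [⟨.cross b, i⟩, ⟨.cap, i + 1⟩] [⟨.cross (!b), i + 1⟩, ⟨.cap, i⟩]
  /-- First Reidemeister move. -/
  | reidemeister1Cup (b : Bool) (i : ℕ) : LocalMove [⟨.cup, i⟩, ⟨.cross b, i⟩] [⟨.cup, i⟩]
  | reidemeister1Cap (b : Bool) (i : ℕ) : LocalMove [⟨.cross b, i⟩, ⟨.cap, i⟩] [⟨.cap, i⟩]
  /-- Second Reidemeister move. -/
  | reidemeister2 (b : Bool) (i : ℕ) : LocalMove [⟨.cross b, i⟩, ⟨.cross (!b), i⟩] []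
  /-- Third Reidemeister move.  For the strands `1, 2, 3` (numbered at the bottom), `b`, `c`, `d`
  say whether `1` is over `2`, `1` is over `3`, and `2` is over `3`; the hypothesis excludes
  exactly the two cyclic patterns. -/
  | reidemeister3 (b c d : Bool) (i : ℕ) (h : b = c ∨ c = d) :
      LocalMove [⟨.cross b, i⟩, ⟨.cross c, i + 1⟩, ⟨.cross d, i⟩]
        [⟨.cross d, i + 1⟩, ⟨.cross c, i⟩, ⟨.cross b, i + 1⟩]

/-- A local move inside a knot diagram. -/
def Move (D D' : KnotDiagram) : Prop :=
  ∃ u v l r, LocalMove l r ∧ D.word = u ++ l ++ v ∧ D'.word = u ++ r ++ v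

/-- Isotopy of knots: the equivalence relation generated by the moves of diagrams. -/
instance isotopy : Setoid KnotDiagram := Relation.EqvGen.setoid Move

/-- Isotopy classes of unoriented knots. -/
def Knot : Type := Quotient isotopy

/-- `D` is a diagram of `K`. -/
def KnotDiagram.Represents (D : KnotDiagram) (K : Knot) : Prop := (Quotient.mk isotopy D) = K

/-! ### Crossing changes and H(2)-moves -/

/-- The diagrams differ by the change of one crossing. -/
def CrossingChange (D D' : KnotDiagram) : Prop :=
  ∃ u v b i, D.word = u ++ [⟨.cross b, i⟩] ++ v ∧ D'.word = u ++ [⟨.cross (!b), i⟩] ++ v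

/-- The two neighbouring parallel strands `)(` of `D` in positions `i`, `i + 1` at one height are
replaced by `≍`, that is, a local maximum below a local minimum. Since both diagrams are
diagrams of knots, the replacement preserves the number of components. -/
def Band (D D' : KnotDiagram) : Prop :=
  ∃ u v i, D.word = u ++ v ∧ D'.word = u ++ [⟨.cap, i⟩, ⟨.cup, i⟩] ++ v

/-- The diagrams differ by one component-preserving H(2)-move, that is, by one tangle replacement
`)( ↔ ≍`. -/
def H2Move (D D' : KnotDiagram) : Prop := Band D D' ∨ Band D' D

/-- The simple graph on isotopy classes of knots in which two different classes are adjacent if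
they have diagrams that are related by `R` (in some order). -/
def knotGraph (R : KnotDiagram → KnotDiagram → Prop) : SimpleGraph Knot :=
  SimpleGraph.fromRel fun K K' =>
    ∃ D D' : KnotDiagram, D.Represents K ∧ D'.Represents K' ∧ R D D'

/-- The Gordian graph. -/
def gordianGraph : SimpleGraph Knot := knotGraph CrossingChange

/-- The H(2)-Gordian graph. -/
def h2GordianGraph : SimpleGraph Knot := knotGraph H2Move

/-- The quotient of a graph by an invariant `p` of its vertices: vertices with the same value of
`p` are identified, and two different classes are adjacent if they contain adjacent vertices. -/
def quotientGraph {V α : Type*} (G : SimpleGraph V) (p : V → α) :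
    SimpleGraph (Quotient (Setoid.ker p)) :=
  SimpleGraph.fromRel fun a b =>
    ∃ K L : V, Quotient.mk (Setoid.ker p) K = a ∧ Quotient.mk (Setoid.ker p) L = b ∧ G.Adj K L

/-- The infinite path graph: its vertices are the positive integers, its edges the `{n, n + 1}`. -/
def pathGraphNat : SimpleGraph ℕ+ := SimpleGraph.fromRel fun m n => n = m + 1

/-! ### Tricolorings -/

/-- The condition at a crossing: the three colors are all equal or all different. -/
def TriRule (x y z : Fin 3) : Prop := (x = y ∧ y = z) ∨ (x ≠ y ∧ y ≠ z ∧ x ≠ z)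

/-- The two sequences of colors, of the strands below and above the layer, come from a proper
tricoloring of the arcs of the layer. -/
inductive Layer.Colored : Layer → List (Fin 3) → List (Fin 3) → Prop
  | cup (l r : List (Fin 3)) (x : Fin 3) :
      Layer.Colored ⟨.cup, l.length⟩ (l ++ r) (l ++ x :: x :: r)
  | cap (l r : List (Fin 3)) (x : Fin 3) :
      Layer.Colored ⟨.cap, l.length⟩ (l ++ x :: x :: r) (l ++ r)
  /-- The over-arc `x` runs to the top right, the under-strand has the colors `y` and `z`. -/
  | crossTrue (l r : List (Fin 3)) (x y z : Fin 3) (h : TriRule x y z) :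
      Layer.Colored ⟨.cross true, l.length⟩ (l ++ x :: y :: r) (l ++ z :: x :: r)
  /-- The over-arc `x` runs to the top left, the under-strand has the colors `y` and `z`. -/
  | crossFalse (l r : List (Fin 3)) (x y z : Fin 3) (h : TriRule x y z) :
      Layer.Colored ⟨.cross false, l.length⟩ (l ++ y :: x :: r) (l ++ x :: z :: r)

/-- `c` lists, layer by layer, the colors of the strands above each layer of `w` in a proper
tricoloring of `w` in which the strands below `w` have the colors `s`. -/
def IsTricoloring : List (Fin 3) → List Layer → List (List (Fin 3)) → Prop
  | _, [], [] => True
  | s, l :: w, s' :: c => l.Colored s s' ∧ IsTricoloring s' w c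
  | _, _, _ => False

/-- The number of proper, possibly trivial, tricolorings of a diagram. -/
noncomputable def KnotDiagram.tri (D : KnotDiagram) : ℕ :=
  Nat.card {c : List (List (Fin 3)) // IsTricoloring [] D.word c}

/-- The tricoloring number of a knot: the minimum, over its diagrams, of the number of proper
tricolorings. -/
noncomputable def tri (K : Knot) : ℕ := sInf {n | ∃ D : KnotDiagram, D.Represents K ∧ n = D.tri}

/-- The invariant `β = log₃ tri`. -/
noncomputable def beta (K : Knot) : ℝ := Real.logb 3 (tri K)

/-! ### Connected sums of trefoils -/

/-- A trefoil tied into one strand: the braid with three crossings on two strands, whose right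
strand is closed up. -/
def trefoilArc : List Layer :=
  [⟨.cup, 1⟩, ⟨.cross true, 0⟩, ⟨.cross true, 0⟩, ⟨.cross true, 0⟩, ⟨.cap, 1⟩]

/-- The standard diagram of the connected sum of `n` trefoils `T(2, 3)`: a round circle, with `n`
trefoils tied one after another into its left strand. -/
def trefoilSumWord (n : ℕ) : List Layer :=
  [⟨.cup, 0⟩] ++ (List.replicate n trefoilArc).flatten ++ [⟨.cap, 0⟩]

end KnotTheory

namespace KnotTheory

/-! ### Transfer operators

A row of colors is extended to an infinite sequence, so that layers act on all rows. -/

/-! Identify the colors with Z/3: three colors are all equal or all different exactly when they sum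
to zero, so tricolorings are solutions of a linear system. Reading a diagram upwards, each layer
acts on functions of rows of colors, and `KnotDiagram.tri_eq_transfer` counts the tricolorings as
the composite of these operators applied to the constant function 1, evaluated at the zero row. Both
sides of every local move define the same operator (`LocalMove.transfer_eq`), so the count is a knot
invariant.

Linearity enters through `TranslateLE`, a substitute for the fact that a nonempty fiber of a linear
map is a translate of its kernel. It shows that the count is a power of 3; the constant colorings
make the exponent positive, so `betaPNat` is defined. It also bounds the effect of a move: split the
colorings into three parts by the difference of two colors near the move. The part with difference
zero is the largest and maps injectively to colorings of the other diagram, whence the factor 3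
(`CrossingChange.tri_le`, `Band.tri_le`, `Band.tri_le'`).

Consequently β changes by at most 1 along an edge. Conversely, a trefoil tied into a strand
multiplies the count by 3 (`transfer_trefoilArc`), and one crossing change or one band unties it
(`changedArc_equiv`, `bandedArc_equiv`); hence sums of trefoils realize every vertex and every edge
of the path. That the diagrams involved are single closed curves is reduced to a decidable check on
blocks of width two (`IsBlock`). -/

/-- Insert two strands of color `x` in positions `i`, `i + 1`. -/
def insertPair (i : ℕ) (x : Fin 3) (s : ℕ → Fin 3) : ℕ → Fin 3 := fun p =>
  if p < i then s p else if p < i + 2 then x else s (p - 2)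

/-- Delete the strands in positions `i`, `i + 1`. -/
def deletePair (i : ℕ) (s : ℕ → Fin 3) : ℕ → Fin 3 := fun p => if p < i then s p else s (p + 2)

/-- The colors above a crossing of the strands `i`, `i + 1`. -/
def crossPair (b : Bool) (i : ℕ) (s : ℕ → Fin 3) : ℕ → Fin 3 := fun p =>
  if p = i then (if b then -(s i + s (i + 1)) else s (i + 1))
  else if p = i + 1 then (if b then s i else -(s i + s (i + 1))) else s p

/-- The sum of `f` over the rows of colors above the layer that are compatible with the row `s`
below it. -/
def Layer.transfer : Layer → ((ℕ → Fin 3) → ℕ) → (ℕ → Fin 3) → ℕ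
  | ⟨.cup, i⟩, f, s => ∑ x, f (insertPair i x s)
  | ⟨.cap, i⟩, f, s => if s i = s (i + 1) then f (deletePair i s) else 0
  | ⟨.cross b, i⟩, f, s => f (crossPair b i s)

/-- The sum of `f` over the upper rows of the colorings of a word with lower row `s`. -/
def transfer : List Layer → ((ℕ → Fin 3) → ℕ) → (ℕ → Fin 3) → ℕ
  | [], f => f
  | l :: w, f => l.transfer (transfer w f)

theorem transfer_append (u v : List Layer) (f : (ℕ → Fin 3) → ℕ) :
    transfer (u ++ v) f = transfer u (transfer v f) := by
  induction u with
  | nil => rfl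
  | cons l u ih => simp only [List.cons_append, transfer, ih]

theorem sum_neg_add_left (a : Fin 3) (g : Fin 3 → ℕ) : ∑ x, g (-(a + x)) = ∑ x, g x :=
  Fintype.sum_equiv ((Equiv.addLeft a).trans (Equiv.neg _)) _ _ fun _ => rfl

theorem fin3_neg_add_self (x : Fin 3) : -(x + x) = x := by revert x; decide
theorem fin3_cross_right (x y : Fin 3) : -(-(x + y) + x) = y := by revert x y; decide
theorem fin3_cross_right' (x y : Fin 3) : -(x + -(x + y)) = y := by revert x y; decide
theorem fin3_cross_left (x y : Fin 3) : -(-(x + y) + y) = x := by revert x y; decide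
theorem fin3_cross_left' (x y : Fin 3) : -(y + -(x + y)) = x := by revert x y; decide
theorem fin3_cross_eq_left (x y : Fin 3) : -(x + y) = x ↔ x = y := by revert x y; decide
theorem fin3_cross_eq_right (x y : Fin 3) : y = -(x + y) ↔ x = y := by revert x y; decide

/-- The two pieces act on disjoint sets of strands, so the operators commute once the position of
`b` is corrected for the strands that `a` creates or removes. -/
theorem transfer_exchange (a b : Piece) (i k : ℕ) (f : (ℕ → Fin 3) → ℕ) (s : ℕ → Fin 3) :
    transfer [⟨a, i⟩, ⟨b, i + a.top + k⟩] f s = transfer [⟨b, i + a.bot + k⟩, ⟨a, i⟩] f s := by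
  rcases a with _ | _ | c <;> rcases b with _ | _ | d <;>
    simp only [Piece.top, Piece.bot] <;> simp only [transfer, Layer.transfer]
  · rw [Finset.sum_comm]
    refine Finset.sum_congr rfl fun x _ => Finset.sum_congr rfl fun y _ => congrArg f ?_
    funext p; grind [insertPair]
  · by_cases h : s (i + 0 + k) = s (i + 0 + k + 1)
    · rw [if_pos h]
      refine Finset.sum_congr rfl fun x _ => ?_
      rw [if_pos (by grind [insertPair])]
      congr 1; funext p; grind [insertPair, deletePair]
    · rw [if_neg h]
      refine Finset.sum_eq_zero fun x _ => ?_
      rw [if_neg (by grind [insertPair])]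
  · refine Finset.sum_congr rfl fun x _ => congrArg f ?_
    funext p; grind [insertPair, crossPair]
  · split_ifs with h
    · refine Finset.sum_congr rfl fun x _ => ?_
      rw [if_pos (by grind [insertPair])]
      congr 1; funext p; grind [insertPair, deletePair]
    · symm
      refine Finset.sum_eq_zero fun x _ => ?_
      rw [if_neg (by grind [insertPair])]
  · have e : deletePair (i + 0 + k) (deletePair i s) = deletePair i (deletePair (i + 2 + k) s) := by
      funext p; grind [deletePair]
    rw [e]
    grind [deletePair]
  · have e : crossPair d (i + 0 + k) (deletePair i s)
        = deletePair i (crossPair d (i + 2 + k) s) := by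
      funext p; grind [deletePair, crossPair]
    rw [e]
    grind [deletePair, crossPair]
  · refine Finset.sum_congr rfl fun x _ => congrArg f ?_
    funext p; grind [insertPair, crossPair]
  · have e : crossPair c i (deletePair (i + 2 + k) s)
        = deletePair (i + 2 + k) (crossPair c i s) := by
      funext p; grind [deletePair, crossPair]
    rw [e]
    grind [deletePair, crossPair]
  · congr 1; funext p; grind [crossPair]

theorem LocalMove.transfer_eq {l r : List Layer} (h : LocalMove l r) (f : (ℕ → Fin 3) → ℕ) :
    transfer l f = transfer r f := by
  funext s
  rcases h with ⟨a, b, i, k⟩ | i | i | ⟨b, i⟩ | ⟨b, i⟩ | ⟨b, i⟩ | ⟨b, i⟩ | ⟨b, i⟩ | ⟨b, c, d, i, h⟩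
  · exact transfer_exchange a b i k f s
  · simp only [transfer, Layer.transfer]
    -- The cap forces the color of the cup to be that of the incoming strand, so one summand
    -- survives.
    rw [Finset.sum_eq_single (s i)]
    · rw [if_pos (by grind [insertPair])]
      congr 1; funext p; grind [insertPair, deletePair]
    · intro x _ hx
      rw [if_neg (by grind [insertPair])]
    · simp
  · simp only [transfer, Layer.transfer]
    rw [Finset.sum_eq_single (s i)]
    · rw [if_pos (by grind [insertPair])]
      congr 1; funext p; grind [insertPair, deletePair]
    · intro x _ hx
      rw [if_neg (by grind [insertPair])]
    · simp
  · simp only [transfer, Layer.transfer]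
    cases b
    · refine Finset.sum_congr rfl fun x _ => congrArg f ?_
      funext p; grind [insertPair, crossPair]
    · rw [← sum_neg_add_left (s i)]
      refine Finset.sum_congr rfl fun x _ => congrArg f ?_
      have := fin3_cross_right (s i) x
      funext p; grind [insertPair, crossPair]
  · simp only [transfer, Layer.transfer]
    have h1 := fin3_cross_left (s i) (s (i + 1))
    have h2 := fin3_cross_right (s i) (s (i + 1))
    have h3 := fin3_cross_left' (s (i + 1)) (s (i + 2))
    have h4 := fin3_cross_right' (s (i + 1)) (s (i + 2))
    have hc : crossPair b i s (i + 1) = crossPair b i s (i + 1 + 1) ↔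
        crossPair (!b) (i + 1) s i = crossPair (!b) (i + 1) s (i + 1) := by
      cases b <;> grind [crossPair]
    simp only [hc]
    split_ifs with h
    · congr 1; funext p; cases b <;> grind [deletePair, crossPair]
    · rfl
  · simp only [transfer, Layer.transfer]
    refine Finset.sum_congr rfl fun x _ => congrArg f ?_
    have := fin3_neg_add_self x
    funext p; cases b <;> grind [insertPair, crossPair]
  · simp only [transfer, Layer.transfer]
    have h1 := fin3_cross_eq_left (s i) (s (i + 1))
    have h2 := fin3_cross_eq_right (s i) (s (i + 1))
    have hc : crossPair b i s i = crossPair b i s (i + 1) ↔ s i = s (i + 1) := by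
      cases b <;> grind [crossPair]
    simp only [hc]
    split_ifs with h
    · congr 1; funext p; grind [deletePair, crossPair]
    · rfl
  · simp only [transfer, Layer.transfer]
    have h1 := fin3_cross_right (s i) (s (i + 1))
    have h2 := fin3_cross_left' (s i) (s (i + 1))
    congr 1; funext p; cases b <;> grind [crossPair]
  · simp only [transfer, Layer.transfer]
    congr 1; funext p
    by_cases hp : p < i ∨ i + 2 < p
    · grind [crossPair]
    · have e1 : i + 1 + 1 ≠ i := by omega
      obtain hp | hp | hp : p = i ∨ p = i + 1 ∨ p = i + 2 := by omega
      all_goals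
        rw [hp]
        -- Only the three strands involved remain: each noncyclic over/under pattern is checked on
        -- all 27 triples of colors.
        rcases h with rfl | rfl <;> cases b <;> [cases d; cases d; cases c; cases c] <;>
          simp [crossPair, e1, e1.symm]
      all_goals
        generalize s i = x, s (i + 1) = y, s (i + 1 + 1) = z
        revert x y z; decide

/-! ### Counting tricolorings -/

/-- This makes the coloring rule linear over Z/3 and shows that the over-arc and one under-arc
determine the other. -/
theorem triRule_iff (x y z : Fin 3) : TriRule x y z ↔ z = -(x + y) := by
  unfold TriRule; revert x y z; decide

/-- The colorings of a word in which the strands below have the colors `s`. -/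
abbrev Colorings (s : List (Fin 3)) (w : List Layer) : Type :=
  {c : List (List (Fin 3)) // IsTricoloring s w c}

theorem colored_cup_iff (l r s' : List (Fin 3)) :
    Layer.Colored ⟨.cup, l.length⟩ (l ++ r) s' ↔ ∃ x, s' = l ++ x :: x :: r := by
  constructor
  · generalize hn : l.length = n
    generalize hs : l ++ r = s
    intro h
    cases h with
    | cup l' r' x =>
      obtain ⟨rfl, rfl⟩ := List.append_inj hs hn
      exact ⟨x, rfl⟩
  · rintro ⟨x, rfl⟩
    exact .cup l r x

theorem colored_cap_iff (l r s' : List (Fin 3)) (x y : Fin 3) :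
    Layer.Colored ⟨.cap, l.length⟩ (l ++ x :: y :: r) s' ↔ x = y ∧ s' = l ++ r := by
  constructor
  · generalize hn : l.length = n
    generalize hs : l ++ x :: y :: r = s
    intro h
    cases h with
    | cap l' r' z =>
      obtain ⟨rfl, h⟩ := List.append_inj hs hn
      grind
  · rintro ⟨rfl, rfl⟩
    exact .cap l r x

theorem colored_cross_iff (b : Bool) (l r s' : List (Fin 3)) (x y : Fin 3) :
    Layer.Colored ⟨.cross b, l.length⟩ (l ++ x :: y :: r) s' ↔
      s' = l ++ (if b then -(x + y) else y) :: (if b then x else -(x + y)) :: r := by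
  constructor
  · generalize hn : l.length = n
    generalize hs : l ++ x :: y :: r = s
    intro h
    cases h with
    | crossTrue l' r' x' y' z h =>
      obtain ⟨rfl, h'⟩ := List.append_inj hs hn
      rw [triRule_iff] at h
      simp only [List.cons.injEq] at h'
      obtain ⟨rfl, rfl, rfl⟩ := h'
      simp [h]
    | crossFalse l' r' x' y' z h =>
      obtain ⟨rfl, h'⟩ := List.append_inj hs hn
      rw [triRule_iff] at h
      simp only [List.cons.injEq] at h'
      obtain ⟨rfl, rfl, rfl⟩ := h'
      simp [h, add_comm]
  · rintro rfl
    cases b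
    · exact .crossFalse l r y x _ ((triRule_iff _ _ _).2 (by simp [add_comm]))
    · exact .crossTrue l r x y _ ((triRule_iff _ _ _).2 (by simp))

/-- A coloring of `l :: w` is a coloring of `w` together with a choice of the colors above `l`. -/
noncomputable def coloringsEquivSigma {ι : Type*} (s : List (Fin 3)) (l : Layer) (w : List Layer)
    (g : ι → List (Fin 3)) (hg : Function.Injective g)
    (h : ∀ s', l.Colored s s' ↔ ∃ x, s' = g x) :
    (Σ x, Colorings (g x) w) ≃ Colorings s (l :: w) :=
  Equiv.ofBijective (fun c => ⟨g c.1 :: c.2.1, (h _).2 ⟨_, rfl⟩, c.2.2⟩) <| by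
    constructor
    · rintro ⟨x, c, hc⟩ ⟨y, d, hd⟩ hcd
      obtain ⟨hxy, rfl⟩ := List.cons.inj (congrArg Subtype.val hcd)
      obtain rfl := hg hxy
      rfl
    · rintro ⟨_ | ⟨s', c⟩, hc⟩
      · exact hc.elim
      · obtain ⟨x, rfl⟩ := (h s').1 hc.1
        exact ⟨⟨x, c, hc.2⟩, rfl⟩

theorem exists_append_of_le {α : Type*} {i k : ℕ} {s : List α} (h : i + k ≤ s.length) :
    ∃ l m r, s = l ++ (m ++ r) ∧ l.length = i ∧ m.length = k :=
  ⟨s.take i, (s.drop i).take k, (s.drop i).drop k, by simp, by simp; omega, by simp; omega⟩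

/-- The colorings of a word are counted by the transfer operator, applied to any infinite row that
extends the row of colors below the word. -/
theorem nonempty_colorings_equiv (w : List Layer) (s : List (Fin 3)) (e : ℕ → Fin 3)
    (he : ∀ p (hp : p < s.length), e p = s[p]) {m : ℕ} (hw : width s.length w = some m) :
    Nonempty (Colorings s w ≃ Fin (transfer w (fun _ => 1) e)) := by
  induction w generalizing s e with
  | nil =>
    refine ⟨@Equiv.ofUnique _ _ ?_ (inferInstanceAs (Unique (Fin 1)))⟩
    refine ⟨⟨⟨[], trivial⟩⟩, ?_⟩
    rintro ⟨_ | ⟨a, c⟩, hc⟩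
    · rfl
    · exact hc.elim
  | cons a w ih =>
    obtain ⟨k, i⟩ := a
    simp only [width] at hw
    split_ifs at hw with hi
    obtain ⟨l, m, r, rfl, rfl, hm⟩ := exists_append_of_le hi
    cases k with
    | cup =>
      simp only [Piece.bot, List.length_eq_zero_iff] at hm
      subst hm
      have key : ∀ x : Fin 3, Nonempty (Colorings (l ++ x :: x :: r) w ≃
          Fin (transfer w (fun _ => 1) (insertPair l.length x e))) := by
        intro x
        refine ih _ _ ?_ (by simpa [Piece.bot, Piece.top, add_assoc] using hw)
        intro p hp
        grind [insertPair]
      exact ⟨(coloringsEquivSigma _ _ w (fun x => l ++ x :: x :: r) (fun x y h => by simpa using h)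
        (colored_cup_iff l r)).symm.trans
        ((Equiv.sigmaCongrRight fun x => (key x).some).trans finSigmaFinEquiv)⟩
    | cap =>
      obtain ⟨x, y, rfl⟩ := List.length_eq_two.1 hm
      have hx := he l.length (by simp)
      have hy := he (l.length + 1) (by simp)
      simp only [transfer, Layer.transfer]
      by_cases hxy : x = y
      · subst hxy
        rw [if_pos (by simp [hx, hy])]
        obtain ⟨f⟩ : Nonempty (Colorings (l ++ r) w ≃
            Fin (transfer w (fun _ => 1) (deletePair l.length e))) := by
          refine ih _ _ ?_ (by simpa [Piece.bot, Piece.top, ← add_assoc] using hw)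
          intro p hp
          grind [deletePair]
        -- Above a cap the row is determined, so the choice is indexed by `Unit`; the same holds for
        -- crossings.
        refine ⟨(coloringsEquivSigma _ _ w (fun _ : Unit => l ++ r) (fun _ _ _ => rfl) ?_).symm.trans
          ((Equiv.uniqueSigma _).trans f)⟩
        intro s'
        simpa using colored_cap_iff l r s' x x
      · rw [if_neg (by simpa [hx, hy] using hxy)]
        refine ⟨@Equiv.equivOfIsEmpty _ _ ⟨?_⟩ (inferInstanceAs (IsEmpty (Fin 0)))⟩
        rintro ⟨_ | ⟨s', c⟩, hc⟩
        · exact hc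
        · exact hxy ((colored_cap_iff l r s' x y).1 hc.1).1
    | cross b =>
      obtain ⟨x, y, rfl⟩ := List.length_eq_two.1 hm
      have hx := he l.length (by simp)
      have hy := he (l.length + 1) (by simp)
      obtain ⟨f⟩ : Nonempty (Colorings
          (l ++ (if b then -(x + y) else y) :: (if b then x else -(x + y)) :: r) w ≃
          Fin (transfer w (fun _ => 1) (crossPair b l.length e))) := by
        refine ih _ _ ?_ (by simpa [Piece.bot, Piece.top, ← add_assoc] using hw)
        intro p hp
        grind [crossPair]
      refine ⟨(coloringsEquivSigma _ _ w
        (fun _ : Unit => l ++ (if b then -(x + y) else y) :: (if b then x else -(x + y)) :: r)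
        (fun _ _ _ => rfl) ?_).symm.trans ((Equiv.uniqueSigma _).trans f)⟩
      intro s'
      simpa using colored_cross_iff b l r s' x y

/-- The row `e` is free beyond the strands of `s`; comparing two extensions of the same `s` is used
in `KnotDiagram.three_le_tri`. -/
theorem card_colorings {w : List Layer} {s : List (Fin 3)} {e : ℕ → Fin 3}
    (he : ∀ p (hp : p < s.length), e p = s[p]) {m : ℕ} (hw : width s.length w = some m) :
    Nat.card (Colorings s w) = transfer w (fun _ => 1) e := by
  obtain ⟨f⟩ := nonempty_colorings_equiv w s e he hw
  rw [Nat.card_congr f, Nat.card_fin]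

theorem KnotDiagram.tri_eq_transfer (D : KnotDiagram) :
    D.tri = transfer D.word (fun _ => 1) 0 :=
  card_colorings (fun p hp => by simp at hp) D.closed

/-! ### Linearity -/

/-- Translation by any row in the support of `g` takes `g` to a function that is at most `f`. -/
def TranslateLE (g f : (ℕ → Fin 3) → ℕ) : Prop := ∀ s v, g v ≠ 0 → g s ≤ f (s - v)

theorem insertPair_sub (i : ℕ) (x y : Fin 3) (s v : ℕ → Fin 3) :
    insertPair i x s - insertPair i y v = insertPair i (x - y) (s - v) := by
  funext p; simp only [insertPair, Pi.sub_apply]; split_ifs <;> rfl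

theorem deletePair_sub (i : ℕ) (s v : ℕ → Fin 3) :
    deletePair i s - deletePair i v = deletePair i (s - v) := by
  funext p; simp only [deletePair, Pi.sub_apply]; split_ifs <;> rfl

theorem crossPair_sub (b : Bool) (i : ℕ) (s v : ℕ → Fin 3) :
    crossPair b i s - crossPair b i v = crossPair b i (s - v) := by
  funext p; simp only [crossPair, Pi.sub_apply]; split_ifs <;> first | rfl | abel

theorem sum_sub_right (y : Fin 3) (g : Fin 3 → ℕ) : ∑ x, g (x - y) = ∑ x, g x :=
  Fintype.sum_equiv (Equiv.subRight y) _ _ fun _ => rfl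

/-- The three row maps commute with subtraction, and the equality required by a cap is inherited by
differences of rows. -/
theorem TranslateLE.layer {g f : (ℕ → Fin 3) → ℕ} (h : TranslateLE g f) (l : Layer) :
    TranslateLE (l.transfer g) (l.transfer f) := by
  obtain ⟨_ | _ | b, i⟩ := l <;> intro s v hv <;> simp only [Layer.transfer] at hv ⊢
  · obtain ⟨y, -, hy⟩ := Finset.exists_ne_zero_of_sum_ne_zero hv
    -- The color `y` extends `v` across the cup with a nonzero value, so translating by the extended
    -- row shifts the summation variable by `y`.
    rw [← sum_sub_right y fun x => f (insertPair i x (s - v))]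
    refine Finset.sum_le_sum fun x _ => ?_
    rw [← insertPair_sub]
    exact h _ _ hy
  · split_ifs at hv with h1
    · by_cases h2 : s i = s (i + 1)
      · rw [if_pos h2, if_pos (by simp [h1, h2]), ← deletePair_sub]
        exact h _ _ hv
      · simp [h2]
    · exact absurd rfl hv
  · rw [← crossPair_sub]
    exact h _ _ hv

theorem TranslateLE.transfer {g f : (ℕ → Fin 3) → ℕ} (h : TranslateLE g f) (w : List Layer) :
    TranslateLE (transfer w g) (transfer w f) := by
  induction w with
  | nil => exact h
  | cons l w ih => exact ih.layer l

theorem TranslateLE.apply_zero_le {g f : (ℕ → Fin 3) → ℕ} (h : TranslateLE g f) : g 0 ≤ f 0 := by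
  by_cases h0 : g 0 = 0
  · simp [h0]
  · simpa using h 0 0 h0

/-- This is the comparison of a fiber with the kernel: once some coloring lies above `v`,
subtracting it embeds the colorings above `s` into those above `s - v`. -/
theorem translateLE_one (w : List Layer) :
    TranslateLE (transfer w fun _ => 1) (transfer w fun _ => 1) :=
  TranslateLE.transfer (fun _ _ _ => le_rfl) w

theorem Layer.transfer_mono {f g : (ℕ → Fin 3) → ℕ} (h : f ≤ g) (l : Layer) :
    l.transfer f ≤ l.transfer g := by
  obtain ⟨_ | _ | b, i⟩ := l <;> intro s <;> simp only [Layer.transfer]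
  · exact Finset.sum_le_sum fun x _ => h _
  · split_ifs
    exacts [h _, le_rfl]
  · exact h _

theorem transfer_mono {f g : (ℕ → Fin 3) → ℕ} (h : f ≤ g) (w : List Layer) :
    transfer w f ≤ transfer w g := by
  induction w with
  | nil => exact h
  | cons l w ih => exact Layer.transfer_mono ih l

theorem transfer_sum (w : List Layer) (g : Fin 3 → (ℕ → Fin 3) → ℕ) (s : ℕ → Fin 3) :
    transfer w (fun s => ∑ d, g d s) s = ∑ d, transfer w (g d) s := by
  induction w generalizing s with
  | nil => rfl
  | cons l w ih =>
    have ih := funext ih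
    obtain ⟨_ | _ | b, i⟩ := l <;> simp only [transfer, Layer.transfer, ih]
    · exact Finset.sum_comm
    · split_ifs <;> simp

/-- If `g` is the sum of three functions, supported on translates of the support of `f`, then the
total count for `g` is at most three times the one for `f`. -/
theorem transfer_le_three_mul (u : List Layer) {f : (ℕ → Fin 3) → ℕ}
    (g : Fin 3 → (ℕ → Fin 3) → ℕ) (h : ∀ d, TranslateLE (g d) f) :
    transfer u (fun s => ∑ d, g d s) 0 ≤ 3 * transfer u f 0 := by
  rw [transfer_sum]
  calc ∑ d, transfer u (g d) 0 ≤ ∑ _d : Fin 3, transfer u f 0 :=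
        Finset.sum_le_sum fun d _ => ((h d).transfer u).apply_zero_le
    _ = 3 * transfer u f 0 := by simp

/-! ### Possible values of the count: powers of three with positive exponent -/

/-- The number of colorings above the zero row is a power of three. -/
theorem exists_transfer_zero_eq_pow (w : List Layer) :
    ∃ k, transfer w (fun _ => 1) 0 = 3 ^ k := by
  induction w with
  | nil => exact ⟨0, rfl⟩
  | cons l w ih =>
    obtain ⟨k, hk⟩ := ih
    have hT := translateLE_one w
    have hpos : transfer w (fun _ => 1) 0 ≠ 0 := by rw [hk]; positivity
    obtain ⟨_ | _ | b, i⟩ := l <;> simp only [transfer, Layer.transfer]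
    · set a : Fin 3 → ℕ := fun x => transfer w (fun _ => 1) (insertPair i x 0) with ha
      have h0 : a 0 = 3 ^ k := by
        rw [← hk, ha]
        show transfer w _ _ = _
        congr 1; funext p; simp [insertPair]
      have hsub : ∀ x y, a y ≠ 0 → a x ≤ a (x - y) := by
        intro x y hy
        have := hT (insertPair i x 0) _ hy
        rwa [insertPair_sub, sub_zero] at this
      have h1 : a 0 ≠ 0 := by rw [h0]; positivity
      change ∃ k, ∑ x, a x = 3 ^ k
      rw [Fin.sum_univ_three]
      -- The support of `a` behaves like a subgroup of Z/3: either only `a 0` is nonzero, or all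
      -- three values agree and the exponent grows by one.
      by_cases hz : a 1 = 0
      · have := hsub 2 1
        by_cases hz2 : a 2 = 0
        · exact ⟨k, by rw [hz, hz2, h0]; rfl⟩
        · have := hsub 0 2 hz2
          have e : (0 : Fin 3) - 2 = 1 := by decide
          rw [e] at this
          omega
      · have e1 := hsub 1 1 hz
        have e2 := hsub 0 1 hz
        have e3 := hsub 2 1 hz
        have e4 : (0 : Fin 3) - 1 = 2 := by decide
        have e5 : (2 : Fin 3) - 1 = 1 := by decide
        rw [sub_self] at e1
        rw [e4] at e2
        rw [e5] at e3
        refine ⟨k + 1, ?_⟩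
        rw [pow_succ]
        omega
    · refine ⟨k, ?_⟩
      rw [if_pos (by simp), ← hk]
      congr 1; funext p; simp [deletePair]
    · refine ⟨k, ?_⟩
      rw [← hk]
      congr 1; funext p; simp [crossPair]

theorem transfer_const_pos (w : List Layer) (x : Fin 3) :
    0 < transfer w (fun _ => 1) (fun _ => x) := by
  induction w with
  | nil => exact one_pos
  | cons l w ih =>
    obtain ⟨_ | _ | b, i⟩ := l <;> simp only [transfer, Layer.transfer]
    · refine Finset.sum_pos' (fun _ _ => Nat.zero_le _) ⟨x, Finset.mem_univ _, ?_⟩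
      refine ih.trans_eq (congrArg _ (funext fun p => ?_))
      simp [insertPair]
    · rw [if_pos trivial]
      refine ih.trans_eq (congrArg _ (funext fun p => ?_))
      simp [deletePair]
    · refine ih.trans_eq (congrArg _ (funext fun p => ?_))
      have := fin3_neg_add_self x
      grind [crossPair]

theorem KnotDiagram.three_le_tri (D : KnotDiagram) : 3 ≤ D.tri := by
  rw [D.tri_eq_transfer]
  obtain ⟨x, ⟨-, n, hn, hx⟩⟩ := D.nonempty
  have hc := D.closed
  unfold IsClosed at hc
  rcases hw : D.word with _ | ⟨⟨k, i⟩, w⟩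
  · simp only [hw, List.take_nil, width, Option.some.injEq] at hn
    omega
  · rw [hw, width] at hc
    split_ifs at hc with hi
    cases k <;> simp only [Piece.bot] at hi hc
    · obtain rfl : i = 0 := by omega
      -- The first layer is a cup on the empty row. Beyond its two strands the row is irrelevant, so
      -- it may be made constant, and a constant coloring exists for each color.
      have key : ∀ x : Fin 3, 1 ≤ transfer w (fun _ => 1) (insertPair 0 x 0) := by
        intro x
        have h1 := card_colorings (w := w) (s := [x, x]) (e := insertPair 0 x 0)
          (by intro p hp; simp at hp; interval_cases p <;> simp [insertPair]) hc
        have h2 := card_colorings (w := w) (s := [x, x]) (e := fun _ => x)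
          (by intro p hp; simp at hp; interval_cases p <;> simp) hc
        rw [← h1, h2]
        exact transfer_const_pos w x
      calc 3 = ∑ _x : Fin 3, 1 := by simp
        _ ≤ _ := Finset.sum_le_sum fun x _ => key x
    · omega
    · omega

theorem KnotDiagram.exists_tri_eq_pow (D : KnotDiagram) : ∃ k : ℕ, D.tri = 3 ^ (k + 1) := by
  obtain ⟨k, hk⟩ := exists_transfer_zero_eq_pow D.word
  rw [← D.tri_eq_transfer] at hk
  rcases k with _ | k
  · have := D.three_le_tri
    omega
  · exact ⟨k, hk⟩

/-! ### Invariance and the effect of crossing changes and bands -/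

theorem Move.tri_eq {D D' : KnotDiagram} (h : Move D D') : D.tri = D'.tri := by
  obtain ⟨u, v, l, r, hlr, h1, h2⟩ := h
  simp only [KnotDiagram.tri_eq_transfer, h1, h2, transfer_append, hlr.transfer_eq]

theorem tri_eq_of_equiv {D D' : KnotDiagram} (h : D ≈ D') : D.tri = D'.tri := by
  induction h with
  | rel _ _ h => exact h.tri_eq
  | refl => rfl
  | symm _ _ _ ih => exact ih.symm
  | trans _ _ _ _ _ ih1 ih2 => exact ih1.trans ih2

theorem KnotDiagram.Represents.tri_eq {D : KnotDiagram} {K : Knot} (h : D.Represents K) :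
    D.tri = KnotTheory.tri K := by
  have : {n | ∃ D : KnotDiagram, D.Represents K ∧ n = D.tri} = {D.tri} := by
    ext n
    constructor
    · rintro ⟨D', hD', rfl⟩
      exact tri_eq_of_equiv (Quotient.exact (hD'.trans h.symm))
    · rintro rfl
      exact ⟨D, h, rfl⟩
  rw [KnotTheory.tri, this, csInf_singleton]

theorem sum_ite_sub_eq (i : ℕ) (f : (ℕ → Fin 3) → ℕ) :
    (fun s => ∑ d : Fin 3, if s i - s (i + 1) = d then f s else 0) = f := by
  funext s
  simp

/-- Two rows with the same difference `d` in positions `i`, `i + 1` differ by a row whose entries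
there are equal. -/
theorem TranslateLE.restrict {f : (ℕ → Fin 3) → ℕ} (h : TranslateLE f f) (i : ℕ) (d : Fin 3) :
    TranslateLE (fun s => if s i - s (i + 1) = d then f s else 0)
      (fun s => if s i = s (i + 1) then f s else 0) := by
  intro s v hv
  simp only at hv ⊢
  split_ifs at hv with h1
  · by_cases h2 : s i - s (i + 1) = d
    · have h3 : (s - v) i = (s - v) (i + 1) := by
        simp only [Pi.sub_apply]
        rw [sub_eq_sub_iff_sub_eq_sub, h1, h2]
      rw [if_pos h2, if_pos h3]
      exact h _ _ hv
    · simp [h2]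
  · exact absurd rfl hv

/-- Where the two strands have equal colors, both types of crossing act trivially; this is the part
of the colorings that a crossing change does not see. -/
theorem crossPair_eq_self {i : ℕ} {s : ℕ → Fin 3} (h : s i = s (i + 1)) (b : Bool) :
    crossPair b i s = s := by
  have := fin3_neg_add_self (s i)
  funext p; grind [crossPair]

theorem CrossingChange.tri_le {D D' : KnotDiagram} (h : CrossingChange D D') :
    D.tri ≤ 3 * D'.tri := by
  obtain ⟨u, v, b, i, h1, h2⟩ := h
  simp only [KnotDiagram.tri_eq_transfer, h1, h2, transfer_append]
  set g := transfer v fun _ => 1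
  rw [← sum_ite_sub_eq i (transfer [⟨.cross b, i⟩] g)]
  refine (transfer_le_three_mul u _ fun d =>
    (((translateLE_one v).transfer [⟨.cross b, i⟩]).restrict i d)).trans
      (Nat.mul_le_mul_left 3 (transfer_mono ?_ u 0))
  intro s
  by_cases hs : s i = s (i + 1)
  · simp [transfer, Layer.transfer, hs, crossPair_eq_self hs, g]
  · simp [hs]

theorem CrossingChange.symm {D D' : KnotDiagram} (h : CrossingChange D D') :
    CrossingChange D' D := by
  obtain ⟨u, v, b, i, h1, h2⟩ := h
  exact ⟨u, v, !b, i, h2, by simpa using h1⟩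

/-- The new color is written as `s i + d` because fixing `d`, rather than the color itself, gives
parts compatible with translation; `d = 0` restores the original row. -/
theorem transfer_cap_cup (i : ℕ) (f : (ℕ → Fin 3) → ℕ) (s : ℕ → Fin 3) :
    transfer [⟨.cap, i⟩, ⟨.cup, i⟩] f s =
      ∑ d, if s i = s (i + 1) then f (insertPair i (s i + d) (deletePair i s)) else 0 := by
  simp only [transfer, Layer.transfer]
  split_ifs
  · exact (Fintype.sum_equiv (Equiv.addLeft (s i)) _ _ fun _ => rfl).symm
  · simp

theorem insertPair_deletePair {i : ℕ} {s : ℕ → Fin 3} (h : s i = s (i + 1)) :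
    insertPair i (s i) (deletePair i s) = s := by
  funext p; grind [insertPair, deletePair]

theorem Band.tri_le {D D' : KnotDiagram} (h : Band D D') : D.tri ≤ 3 * D'.tri := by
  obtain ⟨u, v, i, h1, h2⟩ := h
  simp only [KnotDiagram.tri_eq_transfer, h1, h2, transfer_append]
  set g := transfer v fun _ => 1
  rw [show transfer u g 0 = _ by rw [← sum_ite_sub_eq i g]]
  refine (transfer_le_three_mul u _ fun d => ((translateLE_one v).restrict i d)).trans
      (Nat.mul_le_mul_left 3 (transfer_mono ?_ u 0))
  intro s
  simp only [transfer_cap_cup]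
  -- Rows with equal entries at the band extend over `≍` by giving the cup the color of the cap.
  refine le_trans (le_of_eq ?_) (Finset.single_le_sum (fun _ _ => Nat.zero_le _)
    (Finset.mem_univ (0 : Fin 3)))
  split_ifs with hs
  · rw [add_zero, insertPair_deletePair hs]
  · rfl

theorem Band.tri_le' {D D' : KnotDiagram} (h : Band D D') : D'.tri ≤ 3 * D.tri := by
  obtain ⟨u, v, i, h1, h2⟩ := h
  simp only [KnotDiagram.tri_eq_transfer, h1, h2, transfer_append]
  set g := transfer v fun _ => 1
  rw [funext (transfer_cap_cup i g)]
  -- For fixed `d`, subtracting two colorings of `≍` cancels the jump between cap and cup and leaves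
  -- a coloring of `)(`.
  refine transfer_le_three_mul u _ fun d s v hv => ?_
  split_ifs at hv with h1
  · by_cases h2 : s i = s (i + 1)
    · rw [if_pos h2]
      refine (translateLE_one _ _ _ hv).trans (le_of_eq ?_)
      have h3 : (s - v) i = (s - v) (i + 1) := by simp [h1, h2]
      rw [insertPair_sub, deletePair_sub, add_sub_add_right_eq_sub]
      exact congrArg g (insertPair_deletePair h3)
    · simp [h2]
  · exact absurd rfl hv

theorem H2Move.tri_le {D D' : KnotDiagram} (h : H2Move D D') : D.tri ≤ 3 * D'.tri :=
  h.elim Band.tri_le Band.tri_le'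

theorem H2Move.symm {D D' : KnotDiagram} (h : H2Move D D') : H2Move D' D := Or.symm h

/-! ### Connectivity -/

theorem width_append (n : ℕ) (u v : List Layer) :
    width n (u ++ v) = (width n u).bind fun m => width m v := by
  induction u generalizing n with
  | nil => rfl
  | cons l u ih =>
    simp only [List.cons_append, width]
    split_ifs
    · exact ih _
    · rfl

/-- The arcs of the extremum or the crossing in a layer, in coordinates relative to the layer. -/
def Layer.innerLinks : Layer → List ((ℕ × ℕ) × (ℕ × ℕ))
  | ⟨.cup, i⟩ => [((1, i), (1, i + 1))]
  | ⟨.cap, i⟩ => [((0, i), (0, i + 1))]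
  | ⟨.cross _, i⟩ => [((0, i), (1, i + 1)), ((0, i + 1), (1, i))]

/-- The arcs of a layer with `n` strands below it, in coordinates relative to the layer. -/
def Layer.links (n : ℕ) (l : Layer) : List ((ℕ × ℕ) × (ℕ × ℕ)) :=
  l.innerLinks ++ (List.range l.pos).map (fun p => ((0, p), (1, p))) ++
    (List.range (n - l.piece.bot - l.pos)).map
      fun p => ((0, l.pos + l.piece.bot + p), (1, l.pos + l.piece.top + p))

/-- The arcs of the layers of a word with `n` strands below it, the first layer being at height
`t`. -/
def links : ℕ → ℕ → List Layer → List ((ℕ × ℕ) × (ℕ × ℕ))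
  | _, _, [] => []
  | t, n, l :: w => (l.links n).map (fun e => ((t + e.1.1, e.1.2), (t + e.2.1, e.2.2))) ++
      links (t + 1) (n - l.piece.bot + l.piece.top) w

/-- Add the points that are joined by one of the given arcs to a point of `R`. -/
def spread (E : List ((ℕ × ℕ) × (ℕ × ℕ))) (R : List (ℕ × ℕ)) : List (ℕ × ℕ) :=
  E.foldl (fun R e => if e.1 ∈ R then R.insert e.2 else if e.2 ∈ R then R.insert e.1 else R) R

/-- The points of a word on two strands that are found to be connected to its bottom. -/
def reached (B : List Layer) : List (ℕ × ℕ) :=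
  (spread (links 0 2 B))^[B.length + 1] [(0, 0), (0, 1)]

/-- A tangle of width two at the bottom and at the top, each point of which is connected to the
bottom. -/
def IsBlock (B : List Layer) : Prop :=
  width 2 B = some 2 ∧ ∀ j ∈ List.range (B.length + 1),
    ∀ p ∈ List.range ((width 2 (B.take j)).getD 0), (j, p) ∈ reached B

instance (B : List Layer) : Decidable (IsBlock B) := inferInstanceAs (Decidable (_ ∧ _))

/-- Translation of points upwards. -/
def shift (t : ℕ) (x : ℕ × ℕ) : ℕ × ℕ := (t + x.1, x.2)

theorem joined_of_mem_links_layer {w : List Layer} {t n : ℕ} {l : Layer} (h : w[t]? = some l)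
    {e : (ℕ × ℕ) × (ℕ × ℕ)} (he : e ∈ l.links n) : Joined w (shift t e.1) (shift t e.2) := by
  obtain ⟨k, i⟩ := l
  simp only [Layer.links, List.mem_append, List.mem_map, List.mem_range] at he
  rcases he with (he | ⟨p, hp, rfl⟩) | ⟨p, hp, rfl⟩
  · cases k with
    | cup =>
      simp only [Layer.innerLinks, List.mem_singleton] at he
      subst he
      exact .cup h
    | cap =>
      simp only [Layer.innerLinks, List.mem_singleton] at he
      subst he
      exact .cap h
    | cross b =>
      simp only [Layer.innerLinks, List.mem_cons, List.not_mem_nil, or_false] at he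
      rcases he with rfl | rfl
      · exact .crossRight h
      · exact .crossLeft h
  · exact .left h hp
  · exact .right h p

/-- Here `t` is the height in `w` at which the whole block starts, while `t'` is the height inside
the block and grows in the induction. -/
theorem joined_of_mem_links {w B : List Layer} {t t' n : ℕ}
    (h : ∀ j l, B[j]? = some l → w[t + t' + j]? = some l)
    {e : (ℕ × ℕ) × (ℕ × ℕ)} (he : e ∈ links t' n B) : Joined w (shift t e.1) (shift t e.2) := by
  induction B generalizing t' n with
  | nil => simp [links] at he
  | cons l B ih =>
    simp only [links, List.mem_append, List.mem_map] at he
    rcases he with ⟨e', he', rfl⟩ | he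
    · have := joined_of_mem_links_layer (h 0 l rfl) he'
      simpa [shift, add_assoc] using this
    · refine ih (fun j l' hj => ?_) he
      rw [← h (j + 1) l' (by simpa using hj)]
      congr 1; omega

theorem spread_induction {E : List ((ℕ × ℕ) × (ℕ × ℕ))} {P : ℕ × ℕ → Prop}
    (hE : ∀ e ∈ E, P e.1 ↔ P e.2) {R : List (ℕ × ℕ)} (hR : ∀ x ∈ R, P x) :
    ∀ x ∈ spread E R, P x := by
  induction E generalizing R with
  | nil => exact hR
  | cons e E ih =>
    refine ih (fun e' h => hE e' (List.mem_cons_of_mem _ h)) fun x hx => ?_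
    have he := hE e List.mem_cons_self
    beta_reduce at hx
    split_ifs at hx with h1 h2
    · rcases List.mem_insert_iff.1 hx with rfl | hx
      exacts [he.1 (hR _ h1), hR x hx]
    · rcases List.mem_insert_iff.1 hx with rfl | hx
      exacts [he.2 (hR _ h2), hR x hx]
    · exact hR x hx

/-- Only soundness of the search is needed: if it ran for too few rounds, the test in `IsBlock`
would fail. -/
theorem reached_induction {B : List Layer} {P : ℕ × ℕ → Prop}
    (hE : ∀ e ∈ links 0 2 B, P e.1 ↔ P e.2) (h0 : P (0, 0)) (h1 : P (0, 1)) :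
    ∀ x ∈ reached B, P x := by
  have hR : ∀ x ∈ [((0 : ℕ), (0 : ℕ)), (0, 1)], P x := by simp [h0, h1]
  exact Function.Iterate.rec (fun R => ∀ x ∈ R, P x) hR (fun _ => spread_induction hE) _

/-- In a word that contains a sequence of blocks, all points of these blocks are connected to a
given point if the points below them are. -/
theorem blocks_connected {w : List Layer} {x : ℕ × ℕ} (Bs : List (List Layer))
    (hB : ∀ B ∈ Bs, IsBlock B) (u v : List Layer) (hw : w = u ++ Bs.flatten ++ v)
    (hu : width 0 u = some 2) (h0 : Relation.EqvGen (Joined w) x (u.length, 0))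
    (h1 : Relation.EqvGen (Joined w) x (u.length, 1)) :
    width 0 (u ++ Bs.flatten) = some 2 ∧ ∀ j p, j ≤ Bs.flatten.length →
      IsPoint w (u.length + j, p) → Relation.EqvGen (Joined w) x (u.length + j, p) := by
  induction Bs generalizing u with
  | nil =>
    refine ⟨by simpa using hu, fun j p hj ⟨_, n, hn, hp⟩ => ?_⟩
    obtain rfl : j = 0 := by simpa using hj
    simp only [hw, List.flatten_nil, List.append_nil, add_zero, List.take_left, hu,
      Option.some.injEq] at hn
    simp only at hp
    obtain rfl | rfl : p = 0 ∨ p = 1 := by omega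
    exacts [h0, h1]
  | cons B Bs ih =>
    obtain ⟨hB2, hBr⟩ := hB B List.mem_cons_self
    have hr : ∀ y ∈ reached B, Relation.EqvGen (Joined w) x (shift u.length y) := by
      refine reached_induction (fun e he => ?_) h0 h1
      have := joined_of_mem_links (w := w) (t := u.length) (fun j l hj => ?_) he
      · exact ⟨fun h => h.trans _ _ _ (.rel _ _ this),
          fun h => h.trans _ _ _ (.symm _ _ (.rel _ _ this))⟩
      · have hlt : j < B.length := (List.getElem?_eq_some_iff.1 hj).1
        simp only [hw, List.flatten_cons, List.append_assoc, add_zero]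
        rw [List.getElem?_append_right (by omega), Nat.add_sub_cancel_left,
          List.getElem?_append_left hlt, hj]
    have hmem : ∀ j p m, j ≤ B.length → width 2 (B.take j) = some m → p < m →
        Relation.EqvGen (Joined w) x (u.length + j, p) := fun j p m hj hm hp =>
      hr (j, p) (hBr j (by simp; omega) p (by simpa [hm] using hp))
    have hlen : (u ++ B).length = u.length + B.length := List.length_append
    obtain ⟨ih1, ih2⟩ := ih (fun B' h => hB B' (List.mem_cons_of_mem _ h)) (u ++ B)
      (by simp [hw]) (by simp [width_append, hu, hB2])
      (hlen ▸ hmem B.length 0 2 le_rfl (by simpa using hB2) (by simp))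
      (hlen ▸ hmem B.length 1 2 le_rfl (by simpa using hB2) (by simp))
    refine ⟨by simpa using ih1, fun j p hj hp => ?_⟩
    -- Heights up to the top of `B` are covered by the search in `B`; its two top strands start the
    -- induction for the rest.
    rcases le_total j B.length with h | h
    · obtain ⟨-, n, hn, hp⟩ := hp
      refine hmem j p n h ?_ hp
      simp only [hw, List.flatten_cons, List.append_assoc, List.take_length_add_append] at hn
      rw [width_append, hu, List.take_append_of_le_length h] at hn
      exact hn
    · have e : (u ++ B).length + (j - B.length) = u.length + j := by rw [hlen]; omega
      have := ih2 (j - B.length) p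
        (by simp only [List.flatten_cons, List.length_append] at hj; omega)
      rw [e] at this
      exact this hp

/-- The closure of a sequence of blocks is a knot diagram. -/
def closure (Bs : List (List Layer)) (hB : ∀ B ∈ Bs, IsBlock B) : KnotDiagram :=
  have h := blocks_connected (w := [⟨.cup, 0⟩] ++ Bs.flatten ++ [⟨.cap, 0⟩]) (x := (1, 0)) Bs hB
    [⟨.cup, 0⟩] [⟨.cap, 0⟩] rfl rfl (.refl _) (.rel _ _ (.cup rfl))
  have hc : IsClosed ([⟨.cup, 0⟩] ++ Bs.flatten ++ [⟨.cap, 0⟩]) := by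
    rw [IsClosed, width_append, h.1]; rfl
  have hconn : ∀ x, IsPoint ([⟨.cup, 0⟩] ++ Bs.flatten ++ [⟨.cap, 0⟩]) x →
      Relation.EqvGen (Joined ([⟨.cup, 0⟩] ++ Bs.flatten ++ [⟨.cap, 0⟩])) (1, 0) x := by
    rintro ⟨t, p⟩ hx
    have hx' := hx
    obtain ⟨ht, n, hn, hp⟩ := hx'
    simp only [List.length_append, List.length_singleton] at ht
    simp only at hn hp
    rcases t with _ | t
    · simp [width] at hn
      omega
    · by_cases h' : t ≤ Bs.flatten.length
      · have := h.2 t p h'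
        rw [List.length_singleton, add_comm 1 t] at this
        exact this hx
      · rw [List.take_of_length_le (by simp only [List.length_append, List.length_singleton]; omega),
          show width 0 _ = some 0 from hc] at hn
        simp only [Option.some.injEq] at hn
        omega
  { word := [⟨.cup, 0⟩] ++ Bs.flatten ++ [⟨.cap, 0⟩]
    closed := hc
    nonempty := ⟨(1, 0), by simp, 2, rfl, by simp⟩
    connected := fun x y hx hy => ((hconn x hx).symm).trans _ _ _ (hconn y hy) }

theorem KnotDiagram.ext {D D' : KnotDiagram} (h : D.word = D'.word) : D = D' := by
  cases D; cases D'; cases h; rfl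

/-! ### Sums of trefoils -/

theorem isBlock_trefoilArc : IsBlock trefoilArc := by decide +kernel

theorem forall_isBlock_replicate (n : ℕ) {B : List Layer} (hB : IsBlock B) :
    ∀ A ∈ List.replicate n trefoilArc ++ [B], IsBlock A := by
  intro A hA
  rcases List.mem_append.1 hA with h | h
  · rw [List.eq_of_mem_replicate h]
    exact isBlock_trefoilArc
  · rwa [List.mem_singleton.1 h]

/-- The sum of `n` trefoils and of the closure of the block `B`. -/
def trefoilSumWith (n : ℕ) (B : List Layer) (hB : IsBlock B) : KnotDiagram :=
  closure (List.replicate n trefoilArc ++ [B]) (forall_isBlock_replicate n hB)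

theorem trefoilSumWith_word (n : ℕ) (B : List Layer) (hB : IsBlock B) :
    (trefoilSumWith n B hB).word =
      [⟨.cup, 0⟩] ++ (List.replicate n trefoilArc).flatten ++ B ++ [⟨.cap, 0⟩] := by
  simp [trefoilSumWith, closure]

/-- Isotopy is generated by moves between knot diagrams, so both sides of every single move must be
shown to be blocks. -/
theorem trefoilSumWith_equiv (n : ℕ) {x y l r : List Layer} (h : LocalMove l r)
    (hl : IsBlock (x ++ l ++ y)) (hr : IsBlock (x ++ r ++ y)) :
    trefoilSumWith n _ hl ≈ trefoilSumWith n _ hr :=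
  .rel _ _ ⟨[⟨.cup, 0⟩] ++ (List.replicate n trefoilArc).flatten ++ x, y ++ [⟨.cap, 0⟩], l, r, h,
    by simp [trefoilSumWith_word], by simp [trefoilSumWith_word]⟩

theorem isBlock_nil : IsBlock [] := by decide +kernel

/-- The diagram of the sum of `n` trefoils. -/
def trefoilSum (n : ℕ) : KnotDiagram := trefoilSumWith n [] isBlock_nil

theorem trefoilSum_word (n : ℕ) : (trefoilSum n).word = trefoilSumWord n := by
  simp [trefoilSum, trefoilSumWith_word, trefoilSumWord]

theorem trefoilSum_succ_word (n : ℕ) : (trefoilSum (n + 1)).word =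
    [⟨.cup, 0⟩] ++ (List.replicate n trefoilArc).flatten ++ trefoilArc ++ [⟨.cap, 0⟩] := by
  simp [trefoilSum_word, trefoilSumWord, List.replicate_succ']

/-! ### Untying a trefoil by one move -/

/-- The trefoil arc with its middle crossing changed. -/
def changedArc : List Layer :=
  [⟨.cup, 1⟩, ⟨.cross true, 0⟩, ⟨.cross false, 0⟩, ⟨.cross true, 0⟩, ⟨.cap, 1⟩]

/-- The trefoil arc with a band attached above its lowest crossing. -/
def bandedArc : List Layer :=
  [⟨.cup, 1⟩, ⟨.cross true, 0⟩, ⟨.cap, 0⟩, ⟨.cup, 0⟩, ⟨.cross true, 0⟩, ⟨.cross true, 0⟩,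
    ⟨.cap, 1⟩]

theorem isBlock_changedArc : IsBlock changedArc := by decide +kernel

theorem isBlock_bandedArc : IsBlock bandedArc := by decide +kernel

theorem zigzag_equiv (n : ℕ) (h : IsBlock [⟨.cup, 0⟩, ⟨.cap, 1⟩]) :
    trefoilSumWith n _ h ≈ trefoilSum n :=
  trefoilSumWith_equiv n (x := []) (y := []) (.zigzag 0) h isBlock_nil

/-- The two lowest crossings now cancel. The remaining crossing is a kink only up to planar isotopy:
it is slid across the cup before the first Reidemeister move applies. -/
theorem changedArc_equiv (n : ℕ) : trefoilSumWith n _ isBlock_changedArc ≈ trefoilSum n := by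
  have h1 : IsBlock [⟨.cup, 1⟩, ⟨.cross true, 0⟩, ⟨.cap, 1⟩] := by decide +kernel
  have h2 : IsBlock [⟨.cup, 0⟩, ⟨.cross false, 1⟩, ⟨.cap, 1⟩] := by decide +kernel
  have h3 : IsBlock [⟨.cup, 0⟩, ⟨.cap, 1⟩] := by decide +kernel
  refine Setoid.trans (trefoilSumWith_equiv n (x := [⟨.cup, 1⟩])
    (y := [⟨.cross true, 0⟩, ⟨.cap, 1⟩]) (.reidemeister2 true 0) isBlock_changedArc h1) ?_
  refine Setoid.trans (trefoilSumWith_equiv n (x := []) (y := [⟨.cap, 1⟩])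
    (.slideCup true 0) h1 h2) ?_
  refine Setoid.trans (trefoilSumWith_equiv n (x := [⟨.cup, 0⟩]) (y := [])
    (.reidemeister1Cap false 1) h2 h3) ?_
  exact zigzag_equiv n h3

/-- The band separates the crossings: the lowest becomes a kink under the new cap, the other two
become kinks on the new cup. What remains is straightened. -/
theorem bandedArc_equiv (n : ℕ) : trefoilSumWith n _ isBlock_bandedArc ≈ trefoilSum n := by
  have h1 : IsBlock [⟨.cup, 1⟩, ⟨.cap, 0⟩, ⟨.cup, 0⟩, ⟨.cross true, 0⟩, ⟨.cross true, 0⟩,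
    ⟨.cap, 1⟩] := by decide +kernel
  have h2 : IsBlock [⟨.cup, 1⟩, ⟨.cap, 0⟩, ⟨.cup, 0⟩, ⟨.cross true, 0⟩, ⟨.cap, 1⟩] := by decide +kernel
  have h3 : IsBlock [⟨.cup, 1⟩, ⟨.cap, 0⟩, ⟨.cup, 0⟩, ⟨.cap, 1⟩] := by decide +kernel
  have h4 : IsBlock [⟨.cup, 0⟩, ⟨.cap, 1⟩] := by decide +kernel
  refine Setoid.trans (trefoilSumWith_equiv n (x := [⟨.cup, 1⟩])
    (y := [⟨.cup, 0⟩, ⟨.cross true, 0⟩, ⟨.cross true, 0⟩, ⟨.cap, 1⟩])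
    (.reidemeister1Cap true 0) isBlock_bandedArc h1) ?_
  refine Setoid.trans (trefoilSumWith_equiv n (x := [⟨.cup, 1⟩, ⟨.cap, 0⟩])
    (y := [⟨.cross true, 0⟩, ⟨.cap, 1⟩]) (.reidemeister1Cup true 0) h1 h2) ?_
  refine Setoid.trans (trefoilSumWith_equiv n (x := [⟨.cup, 1⟩, ⟨.cap, 0⟩])
    (y := [⟨.cap, 1⟩]) (.reidemeister1Cup true 0) h2 h3) ?_
  refine Setoid.trans (trefoilSumWith_equiv n (x := []) (y := [⟨.cup, 0⟩, ⟨.cap, 1⟩])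
    (.zagzig 0) h3 h4) ?_
  exact zigzag_equiv n h4

theorem crossingChange_trefoilSum (n : ℕ) :
    CrossingChange (trefoilSumWith n _ isBlock_changedArc) (trefoilSum (n + 1)) :=
  ⟨[⟨.cup, 0⟩] ++ (List.replicate n trefoilArc).flatten ++ [⟨.cup, 1⟩, ⟨.cross true, 0⟩],
    [⟨.cross true, 0⟩, ⟨.cap, 1⟩, ⟨.cap, 0⟩], false, 0,
    by simp [trefoilSumWith_word, changedArc], by simp [trefoilSum_succ_word, trefoilArc]⟩

theorem h2Move_trefoilSum (n : ℕ) :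
    H2Move (trefoilSumWith n _ isBlock_bandedArc) (trefoilSum (n + 1)) :=
  .inr ⟨[⟨.cup, 0⟩] ++ (List.replicate n trefoilArc).flatten ++ [⟨.cup, 1⟩, ⟨.cross true, 0⟩],
    [⟨.cross true, 0⟩, ⟨.cross true, 0⟩, ⟨.cap, 1⟩, ⟨.cap, 0⟩], 0,
    by simp [trefoilSum_succ_word, trefoilArc], by simp [trefoilSumWith_word, bandedArc]⟩

/-- A crossing sends the colors `(x, y)` to `(-(x + y), x)`, a map of order three. After three
crossings the row is as before, so the cap imposes no condition and the color of the cup is free. -/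
theorem transfer_trefoilArc (f : (ℕ → Fin 3) → ℕ) (s : ℕ → Fin 3) :
    transfer trefoilArc f s = 3 * f s := by
  simp only [trefoilArc, transfer, Layer.transfer]
  have key : ∀ x : Fin 3, crossPair true 0 (crossPair true 0 (crossPair true 0
      (insertPair 1 x s))) = insertPair 1 x s := by
    intro x
    have h1 := fin3_cross_right (s 0) x
    have h2 := fin3_cross_left' (s 0) x
    have h3 := fin3_cross_right' (s 0) x
    funext p
    grind [crossPair, insertPair]
  have del : ∀ x : Fin 3, deletePair 1 (insertPair 1 x s) = s := by
    intro x
    funext p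
    grind [deletePair, insertPair]
  simp [key, del, insertPair]

theorem tri_trefoilSum (n : ℕ) : (trefoilSum n).tri = 3 ^ (n + 1) := by
  rw [KnotDiagram.tri_eq_transfer, trefoilSum_word, trefoilSumWord, transfer_append,
    transfer_append]
  have key : ∀ f, transfer (List.replicate n trefoilArc).flatten f = fun s => 3 ^ n * f s := by
    intro f
    induction n with
    | zero => simp [transfer]
    | succ n ih =>
      funext s
      rw [List.replicate_succ, List.flatten_cons, transfer_append, transfer_trefoilArc, ih,
        pow_succ]
      ring
  rw [key]
  simp [transfer, Layer.transfer, insertPair, pow_succ, mul_comm]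

/-- The knot type of the sum of `n` trefoils. -/
def trefoilSumKnot (n : ℕ) : Knot := Quotient.mk isotopy (trefoilSum n)

/-! ### The quotient graphs -/

theorem exists_tri_eq_pow (K : Knot) : ∃ k : ℕ, tri K = 3 ^ (k + 1) := by
  obtain ⟨D, rfl⟩ := Quotient.exists_rep K
  obtain ⟨k, hk⟩ := D.exists_tri_eq_pow
  exact ⟨k, by rw [← hk, KnotDiagram.Represents.tri_eq (D := D) rfl]⟩

theorem beta_eq_of_tri_eq {K : Knot} {k : ℕ} (h : tri K = 3 ^ k) : beta K = k := by
  rw [beta, h, Nat.cast_pow, Nat.cast_ofNat, Real.logb_pow, Real.logb_self_eq_one (by norm_num),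
    mul_one]

theorem exists_beta_eq (K : Knot) : ∃ b : ℕ+, tri K = 3 ^ (b : ℕ) ∧ beta K = (b : ℕ) := by
  obtain ⟨k, hk⟩ := exists_tri_eq_pow K
  exact ⟨k.succPNat, hk, beta_eq_of_tri_eq hk⟩

/-- The invariant `β` with values in the positive integers. -/
noncomputable def betaPNat (K : Knot) : ℕ+ := (exists_beta_eq K).choose

theorem tri_eq_pow_betaPNat (K : Knot) : tri K = 3 ^ (betaPNat K : ℕ) :=
  (exists_beta_eq K).choose_spec.1

theorem beta_eq_betaPNat (K : Knot) : beta K = (betaPNat K : ℕ) :=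
  (exists_beta_eq K).choose_spec.2

theorem beta_eq_iff (K K' : Knot) : beta K = beta K' ↔ betaPNat K = betaPNat K' := by
  rw [beta_eq_betaPNat, beta_eq_betaPNat, Nat.cast_inj, PNat.coe_inj]

theorem tri_trefoilSumKnot (n : ℕ) : tri (trefoilSumKnot n) = 3 ^ (n + 1) := by
  rw [← tri_trefoilSum, KnotDiagram.Represents.tri_eq (D := trefoilSum n) rfl]
  rfl

theorem betaPNat_trefoilSumKnot (n : ℕ) : betaPNat (trefoilSumKnot n) = n.succPNat := by
  apply PNat.eq
  have h := tri_trefoilSumKnot n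
  rw [tri_eq_pow_betaPNat] at h
  exact Nat.pow_right_injective (a := 3) (by norm_num) h

/-- Adjacency also requires different knots; the tricoloring numbers distinguish them. -/
theorem knotGraph_trefoilSumKnot_adj {R : KnotDiagram → KnotDiagram → Prop} {n : ℕ}
    {D : KnotDiagram} (hD : D ≈ trefoilSum n) (hR : R D (trefoilSum (n + 1))) :
    (knotGraph R).Adj (trefoilSumKnot n) (trefoilSumKnot (n + 1)) := by
  refine ⟨fun h => ?_, .inl ⟨D, _, Quotient.sound hD, rfl, hR⟩⟩
  have := congrArg tri h
  rw [tri_trefoilSumKnot, tri_trefoilSumKnot] at this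
  have := Nat.pow_right_injective (a := 3) (by norm_num) this
  omega

theorem tri_le_of_adj {R : KnotDiagram → KnotDiagram → Prop} (hs : ∀ {D D'}, R D D' → R D' D)
    (hR : ∀ {D D'}, R D D' → D.tri ≤ 3 * D'.tri) {K K' : Knot} (h : (knotGraph R).Adj K K') :
    tri K ≤ 3 * tri K' := by
  obtain ⟨-, ⟨D, D', h1, h2, h⟩ | ⟨D, D', h1, h2, h⟩⟩ := h
  · rw [← h1.tri_eq, ← h2.tri_eq]
    exact hR h
  · rw [← h1.tri_eq, ← h2.tri_eq]
    exact hR (hs h)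

theorem betaPNat_le_of_tri_le {K K' : Knot} (h : tri K ≤ 3 * tri K') :
    betaPNat K ≤ betaPNat K' + 1 := by
  rw [tri_eq_pow_betaPNat, tri_eq_pow_betaPNat, ← pow_succ'] at h
  exact (Nat.pow_le_pow_iff_right (by norm_num)).1 h

theorem betaPNat_surjective : Function.Surjective betaPNat := fun b =>
  ⟨trefoilSumKnot b.natPred, by rw [betaPNat_trefoilSumKnot, PNat.succPNat_natPred]⟩

/-- The bijection from the classes of knots with equal `β` to the positive integers. -/
noncomputable def betaEquiv : Quotient (Setoid.ker beta) ≃ ℕ+ :=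
  Equiv.ofBijective (Quotient.lift betaPNat fun K K' h => (beta_eq_iff K K').1 h)
    ⟨fun a b => Quotient.inductionOn₂ a b fun K K' h =>
      Quotient.sound ((beta_eq_iff K K').2 h),
    fun b => (betaPNat_surjective b).imp' (Quotient.mk _) fun _ h => h⟩

theorem betaEquiv_mk (K : Knot) : betaEquiv (Quotient.mk (Setoid.ker beta) K) = betaPNat K := rfl

/-- If adjacent knots have tricoloring numbers that differ by a factor of at most three, and
successive sums of trefoils are adjacent, then `β` identifies the quotient graph with the infinite
path graph. -/
theorem exists_iso_pathGraphNat {G : SimpleGraph Knot}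
    (h1 : ∀ K K', G.Adj K K' → tri K ≤ 3 * tri K')
    (h2 : ∀ n, G.Adj (trefoilSumKnot n) (trefoilSumKnot (n + 1))) :
    ∃ φ : quotientGraph G beta ≃g pathGraphNat,
      ∀ K : Knot, ((φ (Quotient.mk (Setoid.ker beta) K) : ℕ) : ℝ) = beta K := by
  have step : ∀ K K', G.Adj K K' → betaPNat K ≠ betaPNat K' →
      betaPNat K' = betaPNat K + 1 ∨ betaPNat K = betaPNat K' + 1 := by
    intro K K' h hne
    have e1 := betaPNat_le_of_tri_le (h1 K K' h)
    have e2 := betaPNat_le_of_tri_le (h1 K' K h.symm)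
    simp only [← PNat.coe_le_coe, ← PNat.coe_inj, PNat.add_coe, PNat.one_coe, ne_eq]
      at e1 e2 hne ⊢
    omega
  have adj : ∀ a b, betaEquiv b = betaEquiv a + 1 → ∃ K L : Knot,
      Quotient.mk (Setoid.ker beta) K = a ∧ Quotient.mk (Setoid.ker beta) L = b ∧ G.Adj K L := by
    intro a b h
    -- The sum of `n` trefoils has β equal to `n + 1`, so the class with value `m` is represented by
    -- `m - 1` trefoils.
    refine ⟨_, _, betaEquiv.injective ?_, betaEquiv.injective ?_, h2 (betaEquiv a).natPred⟩
    · rw [betaEquiv_mk, betaPNat_trefoilSumKnot, PNat.succPNat_natPred]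
    · rw [betaEquiv_mk, betaPNat_trefoilSumKnot, h]
      apply PNat.eq
      simp [PNat.natPred_add_one]
  refine ⟨⟨betaEquiv, fun {a b} => ?_⟩, fun K => (beta_eq_betaPNat K).symm⟩
  rw [pathGraphNat, quotientGraph, SimpleGraph.fromRel_adj, SimpleGraph.fromRel_adj,
    betaEquiv.injective.ne_iff]
  refine and_congr_right fun hne => ⟨?_, ?_⟩
  · rintro (h | h)
    exacts [.inl (adj a b h), .inr (adj b a h)]
  · rintro (⟨K, L, rfl, rfl, h⟩ | ⟨K, L, rfl, rfl, h⟩)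
    · exact step K L h (betaEquiv.injective.ne hne)
    · exact (step K L h (betaEquiv.injective.ne hne.symm)).symm

end KnotTheory

/-! ### The main theorem -/

theorem theorem1p2 :
    -- `β` induces isomorphisms of both quotient graphs with the infinite path graph
    (∃ φ : KnotTheory.quotientGraph KnotTheory.gordianGraph KnotTheory.beta ≃g
        KnotTheory.pathGraphNat,
      ∀ K : KnotTheory.Knot,
        ((φ (Quotient.mk (Setoid.ker KnotTheory.beta) K) : ℕ) : ℝ) = KnotTheory.beta K) ∧
    (∃ φ : KnotTheory.quotientGraph KnotTheory.h2GordianGraph KnotTheory.beta ≃g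
        KnotTheory.pathGraphNat,
      ∀ K : KnotTheory.Knot,
        ((φ (Quotient.mk (Setoid.ker KnotTheory.beta) K) : ℕ) : ℝ) = KnotTheory.beta K) ∧
    -- the number of tricolorings does not depend on the diagram
    (∀ (D : KnotTheory.KnotDiagram) (K : KnotTheory.Knot), D.Represents K →
      D.tri = KnotTheory.tri K) ∧
    -- connected sums of trefoils realize all values of `β` and all edges
    (∃ T : ℕ → KnotTheory.Knot, ∀ n : ℕ,
      (∃ D : KnotTheory.KnotDiagram, D.Represents (T n) ∧ D.word = KnotTheory.trefoilSumWord n) ∧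
      KnotTheory.beta (T n) = n + 1 ∧
      KnotTheory.gordianGraph.Adj (T n) (T (n + 1)) ∧
      KnotTheory.h2GordianGraph.Adj (T n) (T (n + 1))) ∧
    -- one move changes the tricoloring number by a factor of at most three
    (∀ K K' : KnotTheory.Knot,
      KnotTheory.gordianGraph.Adj K K' ∨ KnotTheory.h2GordianGraph.Adj K K' →
      KnotTheory.tri K ≤ 3 * KnotTheory.tri K' ∧ KnotTheory.tri K' ≤ 3 * KnotTheory.tri K) := by
  have gor : ∀ n, KnotTheory.gordianGraph.Adj (KnotTheory.trefoilSumKnot n)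
      (KnotTheory.trefoilSumKnot (n + 1)) := fun n =>
    KnotTheory.knotGraph_trefoilSumKnot_adj (KnotTheory.changedArc_equiv n)
      (KnotTheory.crossingChange_trefoilSum n)
  have h2 : ∀ n, KnotTheory.h2GordianGraph.Adj (KnotTheory.trefoilSumKnot n)
      (KnotTheory.trefoilSumKnot (n + 1)) := fun n =>
    KnotTheory.knotGraph_trefoilSumKnot_adj (KnotTheory.bandedArc_equiv n)
      (KnotTheory.h2Move_trefoilSum n)
  have gor_le : ∀ K K', KnotTheory.gordianGraph.Adj K K' →
      KnotTheory.tri K ≤ 3 * KnotTheory.tri K' := fun _ _ =>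
    KnotTheory.tri_le_of_adj KnotTheory.CrossingChange.symm KnotTheory.CrossingChange.tri_le
  have h2_le : ∀ K K', KnotTheory.h2GordianGraph.Adj K K' →
      KnotTheory.tri K ≤ 3 * KnotTheory.tri K' := fun _ _ =>
    KnotTheory.tri_le_of_adj KnotTheory.H2Move.symm KnotTheory.H2Move.tri_le
  refine ⟨KnotTheory.exists_iso_pathGraphNat gor_le gor,
    KnotTheory.exists_iso_pathGraphNat h2_le h2, fun D K h => h.tri_eq,
    ⟨KnotTheory.trefoilSumKnot,
      fun n => ⟨⟨_, rfl, KnotTheory.trefoilSum_word n⟩, ?_, gor n, h2 n⟩⟩, ?_⟩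
  · rw [KnotTheory.beta_eq_of_tri_eq (KnotTheory.tri_trefoilSumKnot n)]
    push_cast
    rfl
  · rintro K K' (h | h)
    · exact ⟨gor_le K K' h, gor_le K' K h.symm⟩
    · exact ⟨h2_le K K' h, h2_le K' K h.symm⟩
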